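/- Let $B$ be a unital C*-algebra, let $A\subseteq B$ be a C*-subalgebra containing $1_B$, and let $E:B\to A$ be a conditional expectation, i.e. a positive linear $A$-bimodule map with $E(a)=a$ for $a\in A$. Suppose that $E$ has finite index, i.e. there are $u_1,\dots,u_n\in B$ with $x=\sum_{i=1}^n u_iE(u_i^*x)$ for all $x\in B$, and that the inclusion is irreducible, i.e. $A'\cap B=\mathbb C1_B$. Regard $B$ as a C*-correspondence ${}_AB_A$ over $A$ with inner product $\langle x,y\rangle=E(x^*y)$. Let $T:B\to B$ be a self-adjoint unital morphism of ${}_AB_A$, i.e. a linear map with $T(axa')=aT(x)a'$ for $a,a'\in A$, $x\in B$, with $\langle T(x),y\rangle=\langle x,T(y)\rangle$ for $x,y\in B$, and with $T(1)=1$. Then the following are equivalent: 1. $T$ arises from an intermediate C*-subalgebra, i.e. there is a C*-algebra $C$ with $A\subseteq C\subseteq B$ whose inclusion $i:C\to B$ has an adjoint $i^\dagger:B\to C$ with respect to the inner products $\langle x,y\rangle=E(x^*y)$ on $C$ and $B$, and $T=i\circ i^\dagger$. 2. $T$ is an averaging operator, i.e. $T$ is bounded and $T(T(a)b)=T(a)T(b)=T(aT(b))$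 for all $a,b\in B$. -/

import Mathlib

/-- `E : B → A` is a conditional expectation of the unital C*-algebra `B` onto its unital
C*-subalgebra `A`: a linear projection onto `A` which is an `A`-bimodule map and is positive
(an element of the C*-algebra `A` is positive if and only if it has the form `a⋆ a` with `a` in
`A`). -/
structure IsConditionalExpectation {B : Type*} [CStarAlgebra B] (A : StarSubalgebra ℂ B)
    (E : B →ₗ[ℂ] A) : Prop where
  apply_coe : ∀ a : A, E (a : B) = a
  map_mul_left : ∀ (a : A) (x : B), E ((a : B) * x) = a * E x
  map_mul_right : ∀ (x : B) (a : A), E (x * (a : B)) = E x * a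
  positive : ∀ x : B, ∃ a : A, E (star x * x) = star a * a

/-- `E` has finite (Watatani) index: there is a finite Pimsner–Popa basis `u₁, …, uₙ` of `B`, that
is, `x = ∑ uᵢ E(uᵢ⋆ x)` for all `x` in `B` (taking adjoints, also `x = ∑ E(x uᵢ) uᵢ⋆`). -/
def HasFiniteIndex {B : Type*} [CStarAlgebra B] {A : StarSubalgebra ℂ B} (E : B →ₗ[ℂ] A) : Prop :=
  ∃ (n : ℕ) (u : Fin n → B), ∀ x : B, ∑ i, u i * (E (star (u i) * x) : B) = x

/-- The inclusion `A ⊆ B` is irreducible: the relative commutant `A' ∩ B` consists of the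
scalars. -/
def IsIrreducibleInclusion {B : Type*} [CStarAlgebra B] (A : StarSubalgebra ℂ B) : Prop :=
  Set.centralizer (A : Set B) = Set.range (algebraMap ℂ B)

/-- An irreducible finite-index unital inclusion `(A ⊆ B, E)` of C*-algebras. -/
structure IsIrreducibleFiniteIndexInclusion {B : Type*} [CStarAlgebra B] (A : StarSubalgebra ℂ B)
    (E : B →ₗ[ℂ] A) : Prop where
  isClosed : IsClosed (A : Set B)
  isConditionalExpectation : IsConditionalExpectation A E
  hasFiniteIndex : HasFiniteIndex E
  isIrreducible : IsIrreducibleInclusion A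

/-- The `A`-valued inner product `⟨x, y⟩ = E(x⋆ y)` of the C*-correspondence `B` over `A`. -/
noncomputable def correspondenceInner {B : Type*} [CStarAlgebra B] {A : StarSubalgebra ℂ B} (E : B →ₗ[ℂ] A)
    (x y : B) : A :=
  E (star x * y)

/-- `T : B → B` is a map of `A`-bimodules. -/
structure IsBimoduleMap {B : Type*} [CStarAlgebra B] (A : StarSubalgebra ℂ B)
    (T : B →ₗ[ℂ] B) : Prop where
  map_mul_left : ∀ (a : A) (x : B), T ((a : B) * x) = (a : B) * T x
  map_mul_right : ∀ (x : B) (a : A), T (x * (a : B)) = T x * (a : B)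

/-- `T` is a self-adjoint endomorphism of the C*-correspondence `B` over `A`: it is an adjointable
map of `A`-bimodules, and it is its own adjoint for the `A`-valued inner product. -/
structure IsSelfAdjointMorphism {B : Type*} [CStarAlgebra B] {A : StarSubalgebra ℂ B}
    (E : B →ₗ[ℂ] A) (T : B →ₗ[ℂ] B) : Prop where
  isBimoduleMap : IsBimoduleMap A T
  inner_map_left : ∀ x y : B, correspondenceInner E (T x) y = correspondenceInner E x (T y)

/-- `T` arises from an intermediate C*-subalgebra: there are a C*-algebra `A ⊆ C ⊆ B` and a map
`p : B → C` that is adjoint to the inclusion `i : C → B` for the `A`-valued inner products given by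
`E` (so `p = i†`), such that `T = i i†`. -/
def ArisesFromIntermediate {B : Type*} [CStarAlgebra B] {A : StarSubalgebra ℂ B}
    (E : B →ₗ[ℂ] A) (T : B →ₗ[ℂ] B) : Prop :=
  ∃ C : StarSubalgebra ℂ B, IsClosed (C : Set B) ∧ A ≤ C ∧
    ∃ p : B →ₗ[ℂ] C,
      (∀ (c : C) (x : B),
        correspondenceInner E (c : B) x = correspondenceInner E (c : B) (p x : B)) ∧
      ∀ x : B, T x = (p x : B)

/-- `T` is an averaging operator: a bounded linear operator on `B` that satisfies the exchange
relations. -/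
structure IsAveragingOperator {B : Type*} [CStarAlgebra B] (T : B →ₗ[ℂ] B) : Prop where
  continuous : Continuous T
  map_map_mul : ∀ a b : B, T (T a * b) = T a * T b
  map_mul_map : ∀ a b : B, T (a * T b) = T a * T b

/-! If `T` projects onto `C`, adjointness and nondegeneracy of `E` make `T` left `C`-linear. Right
`C`-linearity needs irreducibility, since `E` is not tracial. With `v i = T (u i)`, a Pimsner–Popa
basis of `C` over `A`, the average `G x = ∑ T (x * v i) * star (v i)` is `C`-bilinear; `E ∘ G` is
then an `A`-bimodule map `B → A`, hence a multiple `r • E`, and `G = r • T` passes right linearity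
to `T`. Conversely, an averaging `T` preserves adjoints, so its fixed points form a closed star
subalgebra onto which it projects. -/

section ConditionalExpectation

variable {B : Type*} [CStarAlgebra B] {A : StarSubalgebra ℂ B} {E : B →ₗ[ℂ] A}

open scoped ComplexOrder in
/-- A conditional expectation, being positive, is continuous and preserves adjoints. -/
theorem IsConditionalExpectation.continuous_coe_and_map_star
    (hE : IsConditionalExpectation A E) :
    Continuous (fun x ↦ (E x : B)) ∧ ∀ x, E (star x) = star (E x) := by
  let _ : PartialOrder B := CStarAlgebra.spectralOrder B
  have _ : StarOrderedRing B := CStarAlgebra.spectralOrderedRing B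
  let F : B →ₚ[ℂ] B := PositiveLinearMap.mk₀ (A.subtype.toLinearMap ∘ₗ E) (by
    intro x hx
    obtain ⟨y, rfl⟩ := CStarAlgebra.nonneg_iff_eq_star_mul_self.mp hx
    obtain ⟨a, ha⟩ := hE.positive y
    change 0 ≤ (E (star y * y) : B)
    rw [ha]
    exact star_mul_self_nonneg (a : B))
  refine ⟨map_continuous F, fun x ↦ Subtype.ext ?_⟩
  exact map_star F x

theorem IsConditionalExpectation.continuous_coe (hE : IsConditionalExpectation A E) :
    Continuous (fun x ↦ (E x : B)) :=
  hE.continuous_coe_and_map_star.1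

theorem IsConditionalExpectation.map_star (hE : IsConditionalExpectation A E) (x : B) :
    E (star x) = star (E x) :=
  hE.continuous_coe_and_map_star.2 x

theorem IsConditionalExpectation.map_star_mul (hE : IsConditionalExpectation A E) (x y : B) :
    E (star x * y) = star (E (star y * x)) := by
  rw [← hE.map_star, star_mul, star_star]

/-- The basis coefficients `E (star (u i) * x)` all vanish. This nondegeneracy lets identities in
`B` be tested under `E`. -/
theorem HasFiniteIndex.eq_zero_of_forall_mul (hI : HasFiniteIndex E) {x : B}
    (hx : ∀ y, E (y * x) = 0) : x = 0 := by
  obtain ⟨n, u, hu⟩ := hI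
  rw [← hu x]
  simp [hx]

theorem HasFiniteIndex.eq_zero_of_forall_mul_right (hE : IsConditionalExpectation A E)
    (hI : HasFiniteIndex E) {x : B} (hx : ∀ y, E (x * y) = 0) : x = 0 := by
  refine star_eq_zero.mp (hI.eq_zero_of_forall_mul fun y ↦ ?_)
  rw [← star_star y, ← star_mul, hE.map_star, hx, star_zero]

/-- For an irreducible finite-index inclusion, every bimodule map `B → A` is a multiple of `E`. -/
theorem IsIrreducibleFiniteIndexInclusion.exists_eq_smul
    (hE : IsIrreducibleFiniteIndexInclusion A E) (φ : B →ₗ[ℂ] A)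
    (hl : ∀ (a : A) (x : B), φ ((a : B) * x) = a * φ x)
    (hr : ∀ (x : B) (a : A), φ (x * (a : B)) = φ x * a) : ∃ r : ℂ, ∀ x, φ x = r • E x := by
  have hc := hE.isConditionalExpectation
  obtain ⟨n, u, hu⟩ := hE.hasFiniteIndex
  -- Applying `φ` to the basis expansion gives `φ = E (b * ·)`; left `A`-linearity then puts `b` in
  -- the relative commutant.
  set b : B := ∑ i, (φ (u i) : B) * star (u i) with hb
  have hφ : ∀ x, φ x = E (b * x) := by
    intro x
    conv_lhs => rw [← hu x]
    simp only [hb, Finset.sum_mul, map_sum, hr, mul_assoc, hc.map_mul_left]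
  have hbA : b ∈ Set.centralizer (A : Set B) := by
    intro a ha
    refine sub_eq_zero.mp (HasFiniteIndex.eq_zero_of_forall_mul_right hc hE.hasFiniteIndex ?_)
    intro y
    have h := hl ⟨a, ha⟩ y
    rw [hφ, hφ, ← hc.map_mul_left] at h
    simp only at h
    rw [sub_mul, map_sub, mul_assoc, mul_assoc, ← h, sub_self]
  rw [hE.isIrreducible] at hbA
  obtain ⟨r, hr'⟩ := hbA
  refine ⟨r, fun x ↦ ?_⟩
  rw [hφ, ← hr', ← Algebra.smul_def, map_smul]

/-- The orthogonal projection onto an intermediate C⋆-algebra of an irreducible finite-index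
inclusion is an averaging operator. -/
theorem ArisesFromIntermediate.isAveragingOperator
    (hE : IsIrreducibleFiniteIndexInclusion A E) {T : B →ₗ[ℂ] B} (hT : IsBimoduleMap A T)
    (h : ArisesFromIntermediate E T) : IsAveragingOperator T := by
  have hc := hE.isConditionalExpectation
  have hI := hE.hasFiniteIndex
  obtain ⟨C, -, hAC, p, hp, hTp⟩ := h
  have hTC : ∀ x, T x ∈ C := fun x ↦ by rw [hTp]; exact (p x).2
  have hadj : ∀ c ∈ C, ∀ x, E (c * x) = E (c * T x) := by
    intro c hcC x
    have := hp ⟨star c, star_mem hcC⟩ x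
    simpa only [correspondenceInner, star_star, ← hTp] using this
  have hadj' : ∀ c ∈ C, ∀ x, E (star x * c) = E (star (T x) * c) := by
    intro c hcC x
    rw [hc.map_star_mul, hadj _ (star_mem hcC), ← hc.map_star_mul]
  -- Testing against `C` suffices: moving `T` across the inner product replaces any test element by
  -- one in `C`.
  have huniq : ∀ c ∈ C, ∀ c' ∈ C, (∀ d ∈ C, E (d * c) = E (d * c')) → c = c' := by
    intro c hcC c' hcC' hd
    refine sub_eq_zero.mp (hI.eq_zero_of_forall_mul fun y ↦ ?_)
    rw [← star_star y, hadj' _ (sub_mem hcC hcC'), mul_sub, map_sub,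
      hd _ (star_mem (hTC _)), sub_self]
  have hfix : ∀ c ∈ C, T c = c := fun c hcC ↦
    huniq _ (hTC c) _ hcC fun d hd ↦ (hadj d hd c).symm
  have hleft : ∀ c ∈ C, ∀ x, T (c * x) = c * T x := by
    intro c hcC x
    refine huniq _ (hTC _) _ (mul_mem hcC (hTC x)) fun d hd ↦ ?_
    rw [← hadj d hd, ← mul_assoc, ← mul_assoc, hadj _ (mul_mem hd hcC)]
  obtain ⟨n, u, hu⟩ := hE.hasFiniteIndex
  have hexp : ∀ x, T x = ∑ i, T (u i) * (E (star (T (u i)) * x) : B) := by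
    intro x
    conv_lhs => rw [← hfix _ (hTC x), ← hu (T x)]
    rw [map_sum]
    refine Finset.sum_congr rfl fun i _ ↦ ?_
    rw [hT.map_mul_right, hadj' _ (hTC x), ← hadj _ (star_mem (hTC _))]
  have hexp' : ∀ c ∈ C, c = ∑ i, (E (c * T (u i)) : B) * star (T (u i)) := by
    intro c hcC
    have h1 := congrArg star (hexp (star c))
    rw [hfix _ (star_mem hcC), star_star, star_sum] at h1
    refine h1.trans (Finset.sum_congr rfl fun i _ ↦ ?_)
    rw [star_mul, hc.map_star_mul, star_star, ← StarMemClass.coe_star, star_star]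
  -- This says that `∑ T (u i) ⊗ star (T (u i))`, balanced over `A`, commutes with `C`: expand `c *
  -- T (u i)` in the basis, then resum over `i`.
  have hcentral : ∀ (x : B), ∀ c ∈ C, ∑ i, T (x * (c * T (u i))) * star (T (u i)) =
      (∑ i, T (x * T (u i)) * star (T (u i))) * c := by
    intro x c hcC
    have h1 : ∀ i, T (x * (c * T (u i))) * star (T (u i)) =
        ∑ j, T (x * T (u j)) * ((E (star (T (u j)) * c * T (u i)) : B) * star (T (u i))) := by
      intro i
      conv_lhs => rw [← hfix _ (mul_mem hcC (hTC (u i))), hexp (c * T (u i))]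
      rw [Finset.mul_sum, map_sum, Finset.sum_mul]
      refine Finset.sum_congr rfl fun j _ ↦ ?_
      rw [← mul_assoc x, hT.map_mul_right, mul_assoc, mul_assoc (star _)]
    rw [Finset.sum_congr rfl fun i _ ↦ h1 i, Finset.sum_comm, Finset.sum_mul]
    refine Finset.sum_congr rfl fun j _ ↦ ?_
    rw [← Finset.mul_sum, mul_assoc, ← hexp' _ (mul_mem (star_mem (hTC _)) hcC)]
  let G : B →ₗ[ℂ] B :=
    ∑ i, LinearMap.mulRight ℂ (star (T (u i))) ∘ₗ T ∘ₗ LinearMap.mulRight ℂ (T (u i))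
  have hG : ∀ x, G x = ∑ i, T (x * T (u i)) * star (T (u i)) := fun x ↦ by
    simp [G]
  have hGC : ∀ x, G x ∈ C := fun x ↦ by
    rw [hG]
    exact sum_mem fun i _ ↦ mul_mem (hTC _) (star_mem (hTC _))
  have hGl : ∀ c ∈ C, ∀ x, G (c * x) = c * G x := by
    intro c hcC x
    simp only [hG, Finset.mul_sum, mul_assoc, hleft c hcC]
  have hGr : ∀ x, ∀ c ∈ C, G (x * c) = G x * c := by
    intro x c hcC
    rw [hG, hG, ← hcentral x c hcC]
    simp only [mul_assoc]
  obtain ⟨r, hr⟩ := hE.exists_eq_smul (E ∘ₗ G)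
    (fun a x ↦ by
      rw [LinearMap.comp_apply, hGl _ (hAC a.2), hc.map_mul_left, LinearMap.comp_apply])
    (fun x a ↦ by
      rw [LinearMap.comp_apply, hGr _ _ (hAC a.2), hc.map_mul_right, LinearMap.comp_apply])
  have hGT : ∀ x, G x = r • T x := by
    intro x
    refine huniq _ (hGC x) _ (SMulMemClass.smul_mem r (hTC x)) fun d hd ↦ ?_
    rw [← hGl d hd, mul_smul_comm, map_smul, ← hadj d hd, ← hr, LinearMap.comp_apply]
  have hright : ∀ x, ∀ c ∈ C, T (x * c) = T x * c := by
    intro x c hcC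
    -- If `r = 0`, then `G 1 = ∑ T (u i) * star (T (u i))` is a vanishing sum of positive terms, so
    -- every `T (u i)` is zero and hence `T = 0`.
    by_cases hr0 : r = 0
    · have h1 : G 1 = 0 := by rw [hGT, hr0, zero_smul]
      let _ : PartialOrder B := CStarAlgebra.spectralOrder B
      have _ : StarOrderedRing B := CStarAlgebra.spectralOrderedRing B
      rw [hG, Finset.sum_eq_zero_iff_of_nonneg (fun i _ ↦ by
        rw [one_mul, hfix _ (hTC _)]; exact mul_star_self_nonneg _)] at h1
      have h2 : ∀ i, T (u i) = 0 := fun i ↦ by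
        have := h1 i (Finset.mem_univ i)
        rw [one_mul, hfix _ (hTC _)] at this
        exact CStarRing.mul_star_self_eq_zero_iff _ |>.mp this
      rw [hexp x, hexp (x * c)]
      simp [h2]
    · have := hGr x c hcC
      rw [hGT, hGT, smul_mul_assoc] at this
      exact smul_right_injective B hr0 this
  refine ⟨?_, fun a b ↦ hleft _ (hTC a) b, fun a b ↦ hright a _ (hTC b)⟩
  rw [show (T : B → B) = fun x ↦ ∑ i, T (u i) * (E (star (T (u i)) * x) : B) from funext hexp]
  exact continuous_finsetSum _ fun i _ ↦
    continuous_const.mul (hc.continuous_coe.comp (continuous_const.mul continuous_id))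

/-- A self-adjoint unital averaging operator preserves adjoints. -/
theorem IsAveragingOperator.map_star (hc : IsConditionalExpectation A E) (hI : HasFiniteIndex E)
    {T : B →ₗ[ℂ] B} (hT : IsSelfAdjointMorphism E T) (hT_one : T 1 = 1)
    (h : IsAveragingOperator T) (x : B) : T (star x) = star (T x) := by
  have hET : ∀ y, E (T y) = E y := fun y ↦ by
    have := hT.inner_map_left 1 y
    simpa [correspondenceInner, hT_one] using this.symm
  refine sub_eq_zero.mp (HasFiniteIndex.eq_zero_of_forall_mul_right hc hI fun y ↦ ?_)
  -- Both exchange relations are used, under `E ∘ T = E`, to move `T` from `y` to `star x`.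
  rw [sub_mul, map_sub, sub_eq_zero, show E (star (T x) * y) = E (star x * T y) from
    hT.inner_map_left x y, ← hET (star x * T y), h.map_mul_map, ← h.map_map_mul, hET]

/-- A self-adjoint unital averaging operator is the projection onto its fixed-point algebra. -/
theorem IsAveragingOperator.arisesFromIntermediate (hc : IsConditionalExpectation A E)
    (hI : HasFiniteIndex E) {T : B →ₗ[ℂ] B} (hT : IsSelfAdjointMorphism E T) (hT_one : T 1 = 1)
    (h : IsAveragingOperator T) : ArisesFromIntermediate E T := by
  have hstar := h.map_star hc hI hT hT_one
  have hTA : ∀ a ∈ A, T a = a := fun a ha ↦ by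
    simpa [hT_one] using hT.isBimoduleMap.map_mul_left ⟨a, ha⟩ 1
  have hidem : ∀ x, T (T x) = T x := fun x ↦ by
    simpa [hT_one] using h.map_map_mul x 1
  let C : StarSubalgebra ℂ B :=
    { carrier := {x | T x = x}
      mul_mem' := fun {a b} (ha : T a = a) (hb : T b = b) ↦ by
        have := h.map_map_mul a b
        rwa [ha, hb] at this
      add_mem' := fun {a b} (ha : T a = a) (hb : T b = b) ↦ by
        change T (a + b) = a + b
        rw [map_add, ha, hb]
      algebraMap_mem' := fun r ↦ hTA _ (algebraMap_mem A r)
      star_mem' := fun {a} (ha : T a = a) ↦ by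
        change T (star a) = star a
        rw [hstar, ha] }
  refine ⟨C, isClosed_eq h.continuous continuous_id, hTA,
    T.codRestrict (Subalgebra.toSubmodule C.toSubalgebra) hidem, fun c x ↦ ?_, fun x ↦ rfl⟩
  have hcT : T (c : B) = c := c.2
  have := hT.inner_map_left (c : B) x
  rw [hcT] at this
  exact this

end ConditionalExpectation

theorem corollary4p13 {B : Type*} [CStarAlgebra B] (A : StarSubalgebra ℂ B) (E : B →ₗ[ℂ] A)
    (hE : IsIrreducibleFiniteIndexInclusion A E) (T : B →ₗ[ℂ] B)
    (hT : IsSelfAdjointMorphism E T) (hT_one : T 1 = 1) :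
    ArisesFromIntermediate E T ↔ IsAveragingOperator T :=
  ⟨fun h ↦ h.isAveragingOperator hE hT.isBimoduleMap, fun h ↦
    h.arisesFromIntermediate hE.isConditionalExpectation hE.hasFiniteIndex hT hT_one⟩
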